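/- Let $\mathbb{D}\subset\mathbb{C}$ be the open unit disc and, for $d\in\mathbb{N}$, let $\mathbb{B}_d=\{z\in\mathbb{C}^d:\|z\|<1\}$ be the open Euclidean unit ball. For the reproducing kernel $K$ of a Hilbert space of functions on a set $X$ with $K(z,z)\neq 0$ for all $z \in X$, put $$\delta_K(z,w)=\Big(1-\frac{|K(z,w)|^2}{K(z,z)K(w,w)}\Big)^{1/2}\qquad(z,w\in X).$$ Let $\delta_{\mathcal{D}}$ be the metric on $\mathbb{D}$ induced in this way by the kernel of the Dirichlet space, $$k(z,w)=\frac{1}{z\overline{w}}\log\Big(\frac{1}{1-z\overline{w}}\Big)\quad (\text{with } k(z,w)=1 \text{ if } z\overline{w}=0),$$ and let $\rho=\delta_{H^2_d}$ be the pseudohyperbolic metric on $\mathbb{B}_d$, that is, the metric induced by the Drury--Arveson kernel $\frac{1}{1-\langle z,w\rangle}$. Then for every finite $d$ there does not exist a bi-Lipschitz map from $(\mathbb{D},\delta_{\mathcal{D}})$ into $(\mathbb{B}_d,\rho)$: there are no map $f:\mathbb{D}\to\mathbb{B}_d$ and constants $m,L\in(0,\infty)$ such that $$m\,\delta_{\mathcal{D}}(z,w)\le\rho(f(z),f(w))\le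 L\,\delta_{\mathcal{D}}(z,w)\qquad\text{for all }z,w\in\mathbb{D}.$$ -/

import Mathlib

open scoped ComplexConjugate

noncomputable section

/-- The distance induced by a kernel `K : X → X → ℂ` of a reproducing kernel Hilbert space on `X`
with nonvanishing diagonal:
`δ(z, w) = (1 - |K(z, w)|² / (K(z, z) K(w, w))) ^ (1/2)`.
For a positive definite kernel the diagonal values are nonnegative reals, so they agree with their
norms, and by the Cauchy-Schwarz inequality the radicand is nonnegative. -/
def kernelDist {X : Type*} (K : X → X → ℂ) (z w : X) : ℝ :=
  Real.sqrt (1 - ‖K z w‖ ^ 2 / (‖K z z‖ * ‖K w w‖))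

/-- The open unit disc in `ℂ`. -/
abbrev OpenDisc : Type := Metric.ball (0 : ℂ) 1

/-- The open unit ball in `ℂ ^ d` with respect to the Euclidean norm. -/
abbrev OpenBall (d : ℕ) : Type := Metric.ball (0 : EuclideanSpace ℂ (Fin d)) 1

/-- The reproducing kernel of the classical Dirichlet space on the open unit disc, normed by
`‖f‖² = ∫ |f'|² dA + ‖f‖²_{H²}`, namely `k(z, w) = (z w̄)⁻¹ log (1 / (1 - z w̄))`,
with its removable singularity at `z w̄ = 0` filled in by the value `1`. The logarithm is the
principal branch; note `Re (1 - z w̄) > 0` on the disc. -/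
def dirichletKernel (z w : OpenDisc) : ℂ :=
  if (z : ℂ) * conj (w : ℂ) = 0 then 1
  else 1 / ((z : ℂ) * conj (w : ℂ)) * Complex.log (1 / (1 - (z : ℂ) * conj (w : ℂ)))

/-- The metric on the disc induced by the Dirichlet space. -/
def dirichletDist (z w : OpenDisc) : ℝ := kernelDist dirichletKernel z w

/-- The reproducing kernel `1 / (1 - ⟨z, w⟩)` of the Drury-Arveson space on the unit ball of
`ℂ ^ d`, where `⟨z, w⟩ = ∑ i, z i * conj (w i)` (Mathlib's `inner` is conjugate-linear in its
first argument). -/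
def druryArvesonKernel (d : ℕ) (z w : OpenBall d) : ℂ :=
  1 / (1 - inner ℂ (w : EuclideanSpace ℂ (Fin d)) (z : EuclideanSpace ℂ (Fin d)))

/-- The pseudohyperbolic metric on the unit ball of `ℂ ^ d`, that is, the metric induced by the
Drury-Arveson space. -/
def pseudohyperbolicDist (d : ℕ) (z w : OpenBall d) : ℝ := kernelDist (druryArvesonKernel d) z w

/-- `f` is bi-Lipschitz from `(X, δ)` into `(Y, ρ)`. -/
def IsBiLipschitz {X Y : Type*} (δ : X → X → ℝ) (ρ : Y → Y → ℝ) (f : X → Y) : Prop :=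
  ∃ m > 0, ∃ L > 0, ∀ z w : X, m * δ z w ≤ ρ (f z) (f w) ∧ ρ (f z) (f w) ≤ L * δ z w

end

open Filter Topology

/-! ### Automorphisms of the unit ball -/

section BallAutomorphism

variable {E : Type*} [NormedAddCommGroup E] [InnerProductSpace ℂ E]

/-! The obstruction is metric. In finite dimension, a pseudohyperbolic ball of radius `R < 1` can be
moved by an automorphism to a Euclidean ball about `0`, so the number of `η`-separated points in it
is bounded independently of its centre (`exists_pseudohyperbolicDist_lt`). In the Dirichlet metric
this fails at every scale: for `0 < σ < 1` there are arbitrarily many points pairwise at distance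
nearly `σ` (`exists_dirichletDist_mem`). They lie on the circle `|z|² = 1 - h ^ p` at arguments `0,
h, 2h, …`: their kernel values grow like `|log h|` off the diagonal and `p |log h|` on it, so all
mutual distances tend to `√(1 - 1 / p²)`. Taking `σ` with `L σ < 1` puts the images in one ball of
radius less than `1`, where they stay separated, a contradiction. -/

theorem inner_self_eq_ofReal_norm_sq (a : E) : inner ℂ a a = (‖a‖ : ℂ) ^ 2 :=
  inner_self_eq_norm_sq_to_K a

theorem one_sub_inner_ne_zero {z w : E} (hz : ‖z‖ < 1) (hw : ‖w‖ < 1) :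
    1 - inner ℂ w z ≠ 0 := by
  intro h
  have h1 : ‖inner ℂ w z‖ ≤ ‖w‖ * ‖z‖ := norm_inner_le_norm w z
  rw [← sub_eq_zero.mp h, norm_one] at h1
  nlinarith [norm_nonneg z, norm_nonneg w]

/-- The involutive automorphism of the unit ball that exchanges `a` and `0`. -/
noncomputable def ballInvolution (a z : E) : E :=
  (1 - inner ℂ a z)⁻¹ • (a - (√(1 - ‖a‖ ^ 2) : ℂ) • z -
    (inner ℂ a z / (1 + (√(1 - ‖a‖ ^ 2) : ℂ))) • a)

/-- The source of the invariance of `ρ`. With `s² = 1 - ‖a‖²` it is an identity of rational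
functions in `s` and the inner products. The coefficient `1 / (1 + s)` equals `(1 - s) / ‖a‖²` for
`a ≠ 0`, and also covers `a = 0`. -/
theorem one_sub_inner_ballInvolution {a z w : E} (ha : ‖a‖ < 1) (hz : ‖z‖ < 1) (hw : ‖w‖ < 1) :
    1 - inner ℂ (ballInvolution a w) (ballInvolution a z) =
      (1 - (‖a‖ : ℂ) ^ 2) * (1 - inner ℂ w z) / ((1 - inner ℂ a z) * (1 - inner ℂ w a)) := by
  have hA : 0 ≤ 1 - ‖a‖ ^ 2 := by nlinarith [norm_nonneg a]
  have h1 := one_sub_inner_ne_zero hz ha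
  have h2 := one_sub_inner_ne_zero ha hw
  unfold ballInvolution
  set s : ℝ := √(1 - ‖a‖ ^ 2) with hs
  have hs0 : 0 ≤ s := Real.sqrt_nonneg _
  have hsq : (s : ℂ) ^ 2 = 1 - (‖a‖ : ℂ) ^ 2 := by
    rw [hs]; exact_mod_cast Real.sq_sqrt hA
  have h3 : 1 + (s : ℂ) ≠ 0 := by
    exact_mod_cast (by positivity : (1 + s) ≠ 0)
  have hn : (‖a‖ : ℂ) ^ 2 = 1 - (s : ℂ) ^ 2 := by rw [hsq]; ring
  simp only [inner_smul_left, inner_smul_right, inner_sub_left, inner_sub_right, map_inv₀,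
    map_sub, map_one, map_div₀, map_add, inner_conj_symm, Complex.conj_ofReal,
    inner_self_eq_ofReal_norm_sq, hn]
  field_simp
  ring

theorem ballInvolution_self {a : E} (ha : ‖a‖ < 1) : ballInvolution a a = 0 := by
  have hA : 0 ≤ 1 - ‖a‖ ^ 2 := by nlinarith [norm_nonneg a]
  unfold ballInvolution
  set s : ℝ := √(1 - ‖a‖ ^ 2) with hs
  have hs0 : 0 ≤ s := Real.sqrt_nonneg _
  have hsq : (s : ℂ) ^ 2 = 1 - (‖a‖ : ℂ) ^ 2 := by
    rw [hs]; exact_mod_cast Real.sq_sqrt hA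
  have h3 : 1 + (s : ℂ) ≠ 0 := by
    exact_mod_cast (by positivity : (1 + s) ≠ 0)
  have hn : inner ℂ a a = 1 - (s : ℂ) ^ 2 := by
    rw [hsq, inner_self_eq_ofReal_norm_sq]; ring
  have : (1 : ℂ) - s - (1 - (s : ℂ) ^ 2) / (1 + s) = 0 := by field_simp; ring
  have h : a - (s : ℂ) • a - ((1 - (s : ℂ) ^ 2) / (1 + s)) • a =
      ((1 : ℂ) - s - (1 - (s : ℂ) ^ 2) / (1 + s)) • a := by
    rw [sub_smul, sub_smul, one_smul]
  rw [hn, h, this, zero_smul, smul_zero]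

theorem one_sub_norm_sq_ballInvolution {a z : E} (ha : ‖a‖ < 1) (hz : ‖z‖ < 1) :
    1 - ‖ballInvolution a z‖ ^ 2 =
      (1 - ‖a‖ ^ 2) * (1 - ‖z‖ ^ 2) / ‖1 - inner ℂ a z‖ ^ 2 := by
  have h := one_sub_inner_ballInvolution ha hz hz
  have hc : 1 - inner ℂ z a = (starRingEnd ℂ) (1 - inner ℂ a z) := by
    rw [map_sub, map_one, inner_conj_symm]
  rw [hc, Complex.mul_conj, Complex.normSq_eq_norm_sq, inner_self_eq_ofReal_norm_sq,
    inner_self_eq_ofReal_norm_sq] at h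
  exact_mod_cast h

theorem norm_ballInvolution_lt_one {a z : E} (ha : ‖a‖ < 1) (hz : ‖z‖ < 1) :
    ‖ballInvolution a z‖ < 1 := by
  have h := one_sub_norm_sq_ballInvolution ha hz
  have h1 : 0 < ‖1 - inner ℂ a z‖ := norm_pos_iff.mpr (one_sub_inner_ne_zero hz ha)
  have h2 : 0 < 1 - ‖a‖ ^ 2 := by nlinarith [norm_nonneg a]
  have h3 : 0 < 1 - ‖z‖ ^ 2 := by nlinarith [norm_nonneg z]
  have h4 : 0 < 1 - ‖ballInvolution a z‖ ^ 2 := by rw [h]; positivity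
  nlinarith [norm_nonneg (ballInvolution a z)]

end BallAutomorphism

/-! ### Uniform total boundedness of pseudohyperbolic balls -/

section Pseudohyperbolic

variable {d : ℕ}

theorem OpenBall.norm_lt (z : OpenBall d) : ‖(z : EuclideanSpace ℂ (Fin d))‖ < 1 :=
  mem_ball_zero_iff.mp z.2

theorem pseudohyperbolicDist_eq (z w : OpenBall d) :
    pseudohyperbolicDist d z w =
      √(1 - (1 - ‖(z : EuclideanSpace ℂ (Fin d))‖ ^ 2) *
        (1 - ‖(w : EuclideanSpace ℂ (Fin d))‖ ^ 2) /
        ‖1 - inner ℂ (w : EuclideanSpace ℂ (Fin d)) (z : EuclideanSpace ℂ (Fin d))‖ ^ 2) := by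
  have key (u : OpenBall d) : ‖druryArvesonKernel d u u‖ =
      (1 - ‖(u : EuclideanSpace ℂ (Fin d))‖ ^ 2)⁻¹ := by
    have hu : 0 < 1 - ‖(u : EuclideanSpace ℂ (Fin d))‖ ^ 2 := by
      nlinarith [norm_nonneg (u : EuclideanSpace ℂ (Fin d)), u.norm_lt]
    have : (1 : ℂ) - inner ℂ (u : EuclideanSpace ℂ (Fin d)) (u : EuclideanSpace ℂ (Fin d)) =
        ((1 - ‖(u : EuclideanSpace ℂ (Fin d))‖ ^ 2 : ℝ) : ℂ) := by
      rw [inner_self_eq_ofReal_norm_sq]; push_cast; ring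
    rw [druryArvesonKernel, this, norm_div, norm_one, Complex.norm_real, Real.norm_of_nonneg hu.le,
      one_div]
  rw [pseudohyperbolicDist, kernelDist, key, key, druryArvesonKernel, norm_div, norm_one]
  congr 2
  rw [div_pow, one_pow, ← mul_inv, div_inv_eq_mul]
  ring

/-- The ball automorphism `ballInvolution`, as a self-map of the subtype `OpenBall d`. -/
noncomputable def OpenBall.involution (a z : OpenBall d) : OpenBall d :=
  ⟨ballInvolution (a : EuclideanSpace ℂ (Fin d)) z,
    mem_ball_zero_iff.mpr (norm_ballInvolution_lt_one a.norm_lt z.norm_lt)⟩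

theorem pseudohyperbolicDist_involution (a z w : OpenBall d) :
    pseudohyperbolicDist d (a.involution z) (a.involution w) = pseudohyperbolicDist d z w := by
  rw [pseudohyperbolicDist_eq, pseudohyperbolicDist_eq]
  simp only [OpenBall.involution]
  rw [one_sub_norm_sq_ballInvolution a.norm_lt z.norm_lt,
    one_sub_norm_sq_ballInvolution a.norm_lt w.norm_lt,
    one_sub_inner_ballInvolution a.norm_lt z.norm_lt w.norm_lt]
  have h1 := norm_ne_zero_iff.mpr (one_sub_inner_ne_zero z.norm_lt a.norm_lt)
  have h2 := norm_ne_zero_iff.mpr (one_sub_inner_ne_zero w.norm_lt a.norm_lt)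
  have h3 := norm_ne_zero_iff.mpr (one_sub_inner_ne_zero z.norm_lt w.norm_lt)
  have hA : 0 < 1 - ‖(a : EuclideanSpace ℂ (Fin d))‖ ^ 2 := by
    nlinarith [norm_nonneg (a : EuclideanSpace ℂ (Fin d)), a.norm_lt]
  have h4 : ‖1 - inner ℂ (w : EuclideanSpace ℂ (Fin d)) (a : EuclideanSpace ℂ (Fin d))‖ =
      ‖1 - inner ℂ (a : EuclideanSpace ℂ (Fin d)) (w : EuclideanSpace ℂ (Fin d))‖ := by
    rw [← Complex.norm_conj, map_sub, map_one, inner_conj_symm]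
  have h5 : ‖(1 : ℂ) - (‖(a : EuclideanSpace ℂ (Fin d))‖ : ℂ) ^ 2‖ =
      1 - ‖(a : EuclideanSpace ℂ (Fin d))‖ ^ 2 := by
    rw [← Real.norm_of_nonneg hA.le, ← Complex.norm_real]; push_cast; ring
  rw [norm_div, norm_mul, norm_mul, h4, h5]
  have := hA.ne'
  field_simp

theorem norm_involution (a z : OpenBall d) :
    ‖(a.involution z : EuclideanSpace ℂ (Fin d))‖ = pseudohyperbolicDist d z a := by
  rw [← pseudohyperbolicDist_involution a z a, pseudohyperbolicDist_eq]
  simp [OpenBall.involution, ballInvolution_self a.norm_lt]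

/-- `ρ²` has denominator `|1 - ⟨z, w⟩|²` and numerator `‖z - w‖² - (‖z‖² ‖w‖² - |⟨z, w⟩|²)`, at most
`‖z - w‖²` by Cauchy-Schwarz. -/
theorem pseudohyperbolicDist_le_norm_sub_div {R : ℝ} (hR : R < 1) {z w : OpenBall d}
    (hz : ‖(z : EuclideanSpace ℂ (Fin d))‖ ≤ R) (hw : ‖(w : EuclideanSpace ℂ (Fin d))‖ ≤ R) :
    pseudohyperbolicDist d z w ≤
      ‖(z : EuclideanSpace ℂ (Fin d)) - (w : EuclideanSpace ℂ (Fin d))‖ / (1 - R) := by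
  rw [pseudohyperbolicDist_eq]
  apply Real.sqrt_le_iff.mpr
  have hw1 := w.norm_lt
  generalize (z : EuclideanSpace ℂ (Fin d)) = z at *
  generalize (w : EuclideanSpace ℂ (Fin d)) = w at *
  have hR' : 0 < 1 - R := by linarith
  have hz0 := norm_nonneg z
  have hw0 := norm_nonneg w
  refine ⟨by positivity, ?_⟩
  have hcs : ‖inner ℂ w z‖ ≤ ‖w‖ * ‖z‖ := norm_inner_le_norm w z
  have hlow : 1 - R ≤ ‖1 - inner ℂ w z‖ := by
    have := norm_sub_norm_le (1 : ℂ) (inner ℂ w z)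
    rw [norm_one] at this
    nlinarith
  have h1 : ‖1 - inner ℂ w z‖ ^ 2 =
      1 - 2 * (inner ℂ w z : ℂ).re + ‖(inner ℂ w z : ℂ)‖ ^ 2 := by
    rw [Complex.sq_norm, Complex.sq_norm, Complex.normSq_apply, Complex.normSq_apply]
    simp only [Complex.sub_re, Complex.one_re, Complex.sub_im, Complex.one_im]
    ring
  have h2 : ‖z - w‖ ^ 2 = ‖z‖ ^ 2 - 2 * (inner ℂ w z : ℂ).re + ‖w‖ ^ 2 := by
    rw [norm_sub_rev, norm_sub_sq (𝕜 := ℂ)]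
    simp only [RCLike.re_to_complex]
    ring
  have hpos : 0 < ‖1 - inner ℂ w z‖ ^ 2 := by nlinarith
  have h3 : 1 - (1 - ‖z‖ ^ 2) * (1 - ‖w‖ ^ 2) / ‖1 - inner ℂ w z‖ ^ 2 ≤
      ‖z - w‖ ^ 2 / ‖1 - inner ℂ w z‖ ^ 2 := by
    rw [sub_le_iff_le_add, ← add_div, le_div_iff₀ hpos, h1, h2]
    nlinarith [norm_nonneg (inner ℂ w z : ℂ)]
  rw [div_pow]
  refine h3.trans ?_
  gcongr

/-- Pseudohyperbolic balls of a fixed radius are totally bounded, uniformly in the centre. -/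
theorem exists_pseudohyperbolicDist_lt {R η : ℝ} (hR : R < 1) (hη : 0 < η) :
    ∃ N : ℕ, ∀ (a : OpenBall d) (g : Fin N → OpenBall d),
      (∀ i, pseudohyperbolicDist d (g i) a ≤ R) →
        ∃ i j, i ≠ j ∧ pseudohyperbolicDist d (g i) (g j) < η := by
  have hR' : 0 < 1 - R := by linarith
  -- Two points in the same `ε`-ball are at Euclidean distance less than `η (1 - R)`, hence at
  -- `ρ`-distance less than `η`.
  set ε := η * (1 - R) / 2 with hε
  have hε0 : 0 < ε := by positivity
  obtain ⟨t, -, htf, ht⟩ := Metric.totallyBounded_iff.mp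
    (isCompact_closedBall (0 : EuclideanSpace ℂ (Fin d)) R).totallyBounded ε hε0 |>.imp
      fun t h ↦ And.intro trivial h
  lift t to Finset (EuclideanSpace ℂ (Fin d)) using htf
  refine ⟨t.card + 1, fun a g hg ↦ ?_⟩
  have hn (i) : ‖(a.involution (g i) : EuclideanSpace ℂ (Fin d))‖ ≤ R :=
    (norm_involution a (g i)).trans_le (hg i)
  have hc (i) : ∃ y ∈ t, dist (a.involution (g i) : EuclideanSpace ℂ (Fin d)) y < ε := by
    simpa using ht (mem_closedBall_zero_iff.mpr (hn i))
  choose c hct hcd using hc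
  obtain ⟨i, -, j, -, hij, hcij⟩ := Finset.exists_ne_map_eq_of_card_lt_of_maps_to
    (s := Finset.univ) (t := t) (by simp) (f := c) (fun i _ ↦ hct i)
  refine ⟨i, j, hij, ?_⟩
  rw [← pseudohyperbolicDist_involution a]
  refine (pseudohyperbolicDist_le_norm_sub_div hR (hn i) (hn j)).trans_lt ?_
  rw [div_lt_iff₀ hR', ← dist_eq_norm]
  have h1 := dist_triangle_right (a.involution (g i) : EuclideanSpace ℂ (Fin d))
    (a.involution (g j)) (c i)
  have h2 := hcd i
  have h3 := hcd j
  rw [← hcij] at h3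
  linarith

end Pseudohyperbolic

/-! ### Nearly equidistant points for the Dirichlet metric -/

section Dirichlet

theorem norm_log_one_div_one_sub {x : ℂ} (hx : ‖x‖ < 1) :
    ‖Complex.log (1 / (1 - x))‖ = ‖Complex.log (1 - x)‖ := by
  have : 0 < (1 - x).re := by
    have := Complex.re_le_norm x
    simp only [Complex.sub_re, Complex.one_re]
    linarith
  rw [one_div, Complex.log_inv, norm_neg]
  intro h
  rw [Complex.arg_eq_pi_iff] at h
  linarith [h.1]

theorem norm_dirichletKernel {z w : OpenDisc} (h : (z : ℂ) * (starRingEnd ℂ) (w : ℂ) ≠ 0) :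
    ‖dirichletKernel z w‖ =
      ‖Complex.log (1 - (z : ℂ) * (starRingEnd ℂ) (w : ℂ))‖ / (‖(z : ℂ)‖ * ‖(w : ℂ)‖) := by
  have hz : ‖(z : ℂ)‖ < 1 := mem_ball_zero_iff.mp z.2
  have hw : ‖(w : ℂ)‖ < 1 := mem_ball_zero_iff.mp w.2
  have hlt : ‖(z : ℂ) * (starRingEnd ℂ) (w : ℂ)‖ < 1 := by
    rw [norm_mul, Complex.norm_conj]
    nlinarith [norm_nonneg (z : ℂ), norm_nonneg (w : ℂ)]
  rw [dirichletKernel, if_neg h, norm_mul, norm_log_one_div_one_sub hlt, norm_div, norm_one,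
    norm_mul, Complex.norm_conj]
  ring

/-- The point `√(1 - u) e^{iθ}` of the disc, meant for `0 < u ≤ 1`. -/
noncomputable def OpenDisc.polar (u : ℝ) (hu : 0 < u) (θ : ℝ) : OpenDisc :=
  ⟨√(1 - u) * Complex.exp (θ * Complex.I), by
    rw [mem_ball_zero_iff, norm_mul, Complex.norm_exp_ofReal_mul_I, mul_one, Complex.norm_real,
      Real.norm_of_nonneg (Real.sqrt_nonneg _), Real.sqrt_lt' one_pos]
    linarith⟩

theorem polar_mul_conj_polar {u : ℝ} (hu : 0 < u) (hu1 : u < 1) (α β : ℝ) :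
    (OpenDisc.polar u hu α : ℂ) * (starRingEnd ℂ) (OpenDisc.polar u hu β : ℂ) =
      (1 - u) * Complex.exp ((α - β : ℝ) * Complex.I) := by
  have h : (√(1 - u) : ℂ) * (√(1 - u) : ℂ) = 1 - u := by
    exact_mod_cast Real.mul_self_sqrt (by linarith : 0 ≤ 1 - u)
  simp only [OpenDisc.polar, map_mul, Complex.conj_ofReal, ← Complex.exp_conj, Complex.conj_I]
  rw [mul_mul_mul_comm, h, ← Complex.exp_add]
  congr 2
  push_cast
  ring

/-- For points of equal modulus the factors `1 / (z w̄)` cancel, leaving only the logarithms. -/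
theorem dirichletDist_polar {u : ℝ} (hu : 0 < u) (hu1 : u < 1) (α β : ℝ) :
    dirichletDist (OpenDisc.polar u hu α) (OpenDisc.polar u hu β) =
      √(1 - (‖Complex.log (1 - (1 - u) * Complex.exp ((α - β : ℝ) * Complex.I))‖ /
        Real.log u) ^ 2) := by
  have hne (α β : ℝ) :
      (OpenDisc.polar u hu α : ℂ) * (starRingEnd ℂ) (OpenDisc.polar u hu β : ℂ) ≠ 0 := by
    rw [polar_mul_conj_polar hu hu1]
    refine mul_ne_zero ?_ (Complex.exp_ne_zero _)
    exact_mod_cast (by linarith : 1 - u ≠ 0)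
  have hnorm (α : ℝ) : ‖(OpenDisc.polar u hu α : ℂ)‖ ≠ 0 :=
    norm_ne_zero_iff.mpr (left_ne_zero_of_mul (hne α α))
  have hdiag : ‖Complex.log (1 - (1 - u) * Complex.exp ((0 : ℝ) * Complex.I))‖ ^ 2 =
      Real.log u ^ 2 := by
    have : (1 : ℂ) - (1 - u) * Complex.exp ((0 : ℝ) * Complex.I) = u := by simp
    rw [this, ← Complex.ofReal_log hu.le, Complex.norm_real, Real.norm_eq_abs, sq_abs]
  rw [dirichletDist, kernelDist, norm_dirichletKernel (hne _ _), norm_dirichletKernel (hne _ _),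
    norm_dirichletKernel (hne _ _), polar_mul_conj_polar hu hu1, polar_mul_conj_polar hu hu1,
    polar_mul_conj_polar hu hu1, sub_self, sub_self]
  congr 2
  rw [div_pow _ (Real.log u), ← hdiag]
  have h1 := hnorm α
  have h2 := hnorm β
  have h3 : ‖Complex.log (1 - (1 - u) * Complex.exp ((0 : ℝ) * Complex.I))‖ ≠ 0 := by
    refine fun h ↦ (Real.log_neg hu hu1).ne ?_
    rw [h] at hdiag
    exact pow_eq_zero_iff two_ne_zero |>.mp (by rw [← hdiag]; norm_num)
  field_simp

/-- The numerator is `(1 - e^{ixh}) + h ^ p e^{ixh}`, and the second term is `o(h)` because `p > 1`.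
-/
theorem tendsto_one_sub_mul_exp_div {p : ℝ} (hp : 1 < p) (x : ℝ) :
    Tendsto (fun h : ℝ ↦ (1 - (1 - (h ^ p : ℝ)) * Complex.exp ((x * h : ℝ) * Complex.I)) / (h : ℂ))
      (𝓝[>] 0) (𝓝 (-(x * Complex.I))) := by
  have hd : HasDerivAt (fun h : ℝ ↦ Complex.exp ((x * h : ℝ) * Complex.I)) (x * Complex.I) 0 := by
    have h1 : HasDerivAt (fun h : ℝ ↦ ((x * h : ℝ) : ℂ) * Complex.I) (x * Complex.I) 0 := by
      have := ((hasDerivAt_id (0 : ℝ)).const_mul x).ofReal_comp.mul_const Complex.I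
      simpa using this
    simpa using h1.cexp
  have h1 := hd.tendsto_slope_zero_right
  have h2 : Tendsto (fun h : ℝ ↦ ((h ^ (p - 1) : ℝ) : ℂ)) (𝓝[>] 0) (𝓝 0) := by
    have : ContinuousAt (fun h : ℝ ↦ ((h ^ (p - 1) : ℝ) : ℂ)) 0 :=
      Complex.continuous_ofReal.continuousAt.comp
        (Real.continuousAt_rpow_const _ _ (Or.inr (by linarith)))
    have := this.tendsto
    rw [Real.zero_rpow (by linarith), Complex.ofReal_zero] at this
    exact this.mono_left nhdsWithin_le_nhds
  have h3 : Tendsto (fun h : ℝ ↦ Complex.exp ((x * h : ℝ) * Complex.I)) (𝓝[>] 0) (𝓝 1) := by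
    simpa using hd.continuousAt.tendsto.mono_left (nhdsWithin_le_nhds (s := Set.Ioi 0))
  have h4 := (h2.mul h3).sub h1
  rw [zero_mul, zero_sub] at h4
  refine h4.congr' ?_
  filter_upwards [self_mem_nhdsWithin] with h hh
  have hh : 0 < h := hh
  have hc : (h : ℂ) ≠ 0 := by exact_mod_cast hh.ne'
  have hpow : (h ^ p : ℝ) = h ^ (p - 1) * h := by
    rw [Real.rpow_sub_one hh.ne']; field_simp
  rw [hpow]
  simp only [zero_add, mul_zero, Complex.ofReal_zero, zero_mul, Complex.exp_zero,
    Complex.real_smul]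
  push_cast
  field_simp
  ring

/-- `log (g h) = log h + O(1)`: the real part by the limit of `g h / h`, the imaginary part because
an argument is at most `π` in absolute value. -/
theorem tendsto_norm_log_div_log {g : ℝ → ℂ} {b : ℂ} (hb : b ≠ 0)
    (hg : Tendsto (fun h : ℝ ↦ g h / (h : ℂ)) (𝓝[>] 0) (𝓝 b)) :
    Tendsto (fun h : ℝ ↦ ‖Complex.log (g h)‖ / |Real.log h|) (𝓝[>] 0) (𝓝 1) := by
  have hinv : Tendsto (fun h : ℝ ↦ (Real.log h)⁻¹) (𝓝[>] 0) (𝓝 0) :=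
    tendsto_inv_atBot_zero.comp Real.tendsto_log_nhdsGT_zero
  have hre : Tendsto (fun h : ℝ ↦ 1 + Real.log ‖g h / (h : ℂ)‖ * (Real.log h)⁻¹) (𝓝[>] 0)
      (𝓝 1) := by
    simpa using ((hg.norm.log (norm_ne_zero_iff.mpr hb)).mul hinv).const_add 1
  have him : Tendsto (fun h : ℝ ↦ Complex.arg (g h) * (Real.log h)⁻¹) (𝓝[>] 0) (𝓝 0) := by
    refine squeeze_zero_norm (a := fun h ↦ Real.pi * ‖(Real.log h)⁻¹‖) (fun h ↦ ?_) ?_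
    · rw [norm_mul]
      gcongr
      exact Complex.abs_arg_le_pi _
    · simpa using hinv.norm.const_mul Real.pi
  have hc : Tendsto (fun h : ℝ ↦ ((1 + Real.log ‖g h / (h : ℂ)‖ * (Real.log h)⁻¹ : ℝ) : ℂ) +
      ((Complex.arg (g h) * (Real.log h)⁻¹ : ℝ) : ℂ) * Complex.I) (𝓝[>] 0) (𝓝 1) := by
    simpa using hre.ofReal.add (him.ofReal.mul_const Complex.I)
  have hn := hc.norm
  rw [norm_one] at hn
  refine hn.congr' ?_
  have hg0 : ∀ᶠ h : ℝ in 𝓝[>] 0, g h / (h : ℂ) ≠ 0 := hg.eventually_ne hb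
  filter_upwards [self_mem_nhdsWithin, hg0, Ioo_mem_nhdsGT (one_pos : (0 : ℝ) < 1)]
    with h hh hgh h1
  have hh : 0 < h := hh
  have hlog : Real.log h ≠ 0 := (Real.log_neg hh h1.2).ne
  have hgn : ‖g h‖ ≠ 0 := norm_ne_zero_iff.mpr (div_ne_zero_iff.mp hgh).1
  have hl : Real.log ‖g h / (h : ℂ)‖ = Real.log ‖g h‖ - Real.log h := by
    rw [norm_div, Complex.norm_real, Real.norm_of_nonneg hh.le, Real.log_div hgn hh.ne']
  rw [← Real.norm_eq_abs, ← Complex.norm_real, ← norm_div, hl, Complex.log]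
  congr 1
  have : (Real.log h : ℂ) ≠ 0 := by exact_mod_cast hlog
  push_cast
  field_simp
  ring

theorem tendsto_dirichletDist_polar {p : ℝ} (hp : 1 < p) {x y : ℝ} (hxy : x ≠ y) :
    Tendsto (fun h : ℝ ↦ √(1 - (‖Complex.log (1 - (1 - (h ^ p : ℝ)) *
      Complex.exp ((x * h - y * h : ℝ) * Complex.I))‖ / Real.log (h ^ p)) ^ 2))
      (𝓝[>] 0) (𝓝 (√(1 - (1 / p) ^ 2))) := by
  have hb : -(((x - y : ℝ) : ℂ) * Complex.I) ≠ 0 :=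
    neg_ne_zero.mpr (mul_ne_zero (by exact_mod_cast sub_ne_zero.mpr hxy) Complex.I_ne_zero)
  have h1 := tendsto_norm_log_div_log hb (tendsto_one_sub_mul_exp_div hp (x - y))
  have h2 := ((h1.div_const p).pow 2).const_sub 1 |>.sqrt
  refine h2.congr' ?_
  filter_upwards [self_mem_nhdsWithin] with h hh
  rw [Real.log_rpow hh, sub_mul x y h]
  congr 2
  simp only [div_pow, mul_pow, sq_abs]
  rw [div_div, mul_comm (p ^ 2)]

/-- For `0 < σ < 1`, the Dirichlet metric admits arbitrarily many points that are pairwise at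
distance almost `σ`. -/
theorem exists_dirichletDist_mem {σ : ℝ} (hσ0 : 0 < σ) (hσ1 : σ < 1) {U : Set ℝ} (hU : U ∈ 𝓝 σ)
    (N : ℕ) : ∃ z : Fin N → OpenDisc, ∀ i j, i ≠ j → dirichletDist (z i) (z j) ∈ U := by
  have hc0 : 0 < 1 - σ ^ 2 := by nlinarith
  -- The exponent `p = 1 / c` solves `√(1 - 1 / p²) = σ`.
  set c := √(1 - σ ^ 2) with hc
  have hcpos : 0 < c := Real.sqrt_pos.mpr hc0
  have hc1 : c < 1 := by
    rw [hc, Real.sqrt_lt' one_pos]; nlinarith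
  have hp : 1 < 1 / c := by rwa [lt_div_iff₀ hcpos, one_mul]
  have hlim : √(1 - (1 / (1 / c)) ^ 2) = σ := by
    rw [one_div_one_div, hc, Real.sq_sqrt hc0.le, sub_sub_cancel, Real.sqrt_sq hσ0.le]
  have hev : ∀ᶠ h : ℝ in 𝓝[>] 0, ∀ i j : Fin N, i ≠ j →
      √(1 - (‖Complex.log (1 - (1 - (h ^ (1 / c) : ℝ)) *
      Complex.exp ((((i : ℕ) : ℝ) * h - ((j : ℕ) : ℝ) * h : ℝ) * Complex.I))‖ /
        Real.log (h ^ (1 / c))) ^ 2) ∈ U := by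
    simp only [eventually_all]
    intro i j hij
    have hne : ((i : ℕ) : ℝ) ≠ ((j : ℕ) : ℝ) := by
      exact_mod_cast fun h ↦ hij (Fin.ext h)
    have := tendsto_dirichletDist_polar hp hne
    rw [hlim] at this
    exact this hU
  -- There are finitely many pairs, so one `h` serves them all.
  obtain ⟨h, hh, h01⟩ := (hev.and (Ioo_mem_nhdsGT (one_pos : (0 : ℝ) < 1))).exists
  have hu : 0 < h ^ (1 / c) := Real.rpow_pos_of_pos h01.1 _
  have hu1 : h ^ (1 / c) < 1 := Real.rpow_lt_one h01.1.le h01.2 (by positivity)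
  refine ⟨fun i ↦ OpenDisc.polar _ hu (((i : ℕ) : ℝ) * h), fun i j hij ↦ ?_⟩
  rw [dirichletDist_polar hu hu1]
  exact hh i j hij

end Dirichlet

theorem theorem3p10 (d : ℕ) :
    ¬ ∃ f : OpenDisc → OpenBall d, IsBiLipschitz dirichletDist (pseudohyperbolicDist d) f := by
  rintro ⟨f, m, hm, L, hL, hf⟩
  -- `σ = 1 / (L + 2)` leaves room for distances up to `1 / (L + 1)`, which `f` maps to at most `L /
  -- (L + 1) < 1`.
  have hσ0 : 0 < 1 / (L + 2) := by positivity
  have hσ1 : 1 / (L + 2) < 1 := by rw [div_lt_one (by positivity)]; linarith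
  have hR : L / (L + 1) < 1 := by rw [div_lt_one (by positivity)]; linarith
  obtain ⟨N, hN⟩ := exists_pseudohyperbolicDist_lt (d := d) hR
    (by positivity : 0 < m * (1 / (L + 2) / 2))
  have hU : Set.Ioo (1 / (L + 2) / 2) (1 / (L + 1)) ∈ 𝓝 (1 / (L + 2)) :=
    Ioo_mem_nhds (by linarith) (by gcongr; norm_num)
  -- The extra point is the centre of the ball containing the other `N` images.
  obtain ⟨z, hz⟩ := exists_dirichletDist_mem hσ0 hσ1 hU (N + 1)
  obtain ⟨i, j, hij, hlt⟩ := hN (f (z (Fin.last N))) (fun i ↦ f (z i.castSucc)) fun i ↦ by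
    refine (hf _ _).2.trans ?_
    rw [div_eq_mul_one_div]
    gcongr
    exact (hz _ _ (Fin.castSucc_lt_last i).ne).2.le
  have h1 := (hz i.castSucc j.castSucc fun h ↦ hij (Fin.castSucc_injective N h)).1
  have h2 := (hf (z i.castSucc) (z j.castSucc)).1
  have h3 := mul_lt_mul_of_pos_left h1 hm
  linarith
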